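/- Let $n \ge 0$ and $m\ge 1$ be integers with $m \le 2n+1$. Let $Q=\begin{pmatrix}0&I_m\\ I_m&0\end{pmatrix}$, let $SO_{2m}=\{g\in SL_{2m}(\mathbb C)\mid g^tQg=Q\}$ and $\mathfrak{so}_{2m}=\{A\in \mathrm{Mat}_{2m}(\mathbb C)\mid A^tQ=-QA\}$, and let $$Z=\{A\in\mathfrak{so}_{2m}\mid A^2=0,\ \operatorname{rk}A\le\min\{2n,m\}\}$$ (with its reduced structure). A nilpotent orbit with partition $[d_1,\dots,d_r]$ of $2m$ is the orbit, under the adjoint action $g\cdot A=gAg^{-1}$ of $SO_{2m}$, of a nilpotent element of $\mathfrak{so}_{2m}$ whose Jordan normal form has blocks of sizes $d_1,\dots,d_r$; if there is exactly one such orbit, it is denoted $\mathcal O_{[d_1,\dots,d_r]}$. Write $\overline{\mathcal O}$ for the Zariski closure of $\mathcal O$. (1) If $m$ is odd, then for every integer $0\le k\le\frac{m-1}2$ there is exactly one nilpotent orbit with partition $[2^{2k},1^{2(m-2k)}]$, and $$Z=\bigcup_{k=0}^{\frac{m-1}{2}}\mathcal O_{[2^{2k},1^{2(m-2k)}]}=\overline{\mathcal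 O}_{[2^{m-1},1^2]}.$$ (2) If $m$ is even, then for every integer $0\le k\le \frac m2-1$ there is exactly one nilpotent orbit with partition $[2^{2k},1^{2(m-2k)}]$, there are exactly two nilpotent orbits $\mathcal O^{I}_{[2^m]}\neq\mathcal O^{II}_{[2^m]}$ with partition $[2^m]$, and $$Z=\bigcup_{k=0}^{\frac{m}{2}-1}\mathcal O_{[2^{2k},1^{2(m-2k)}]}\cup\mathcal O^{I}_{[2^m]}\cup\mathcal O^{II}_{[2^m]}=\overline{\mathcal O}^{I}_{[2^m]}\cup\overline{\mathcal O}^{II}_{[2^m]}.$$ -/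

import Mathlib

open Matrix

attribute [local instance] LieRing.ofAssociativeRing

/-- The Lie algebra `𝔰𝔬_{2m}` over `ℂ` of the quadratic form with Gram matrix
`Q = [[0, I_m], [I_m, 0]]`: all `A` with `Aᵀ Q = - Q A`. -/
abbrev SoLie (m : ℕ) : LieSubalgebra ℂ (Matrix (Fin m ⊕ Fin m) (Fin m ⊕ Fin m) ℂ) :=
  LieAlgebra.Orthogonal.typeD (Fin m) ℂ

/-- The special orthogonal group `SO_{2m}` of the quadratic form with Gram matrix
`Q = [[0, I_m], [I_m, 0]]`: all `g` with `det g = 1` and `gᵀ Q g = Q`. -/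
def SoGroup (m : ℕ) : Subgroup (Matrix.SpecialLinearGroup (Fin m ⊕ Fin m) ℂ) where
  carrier := {g | (g : Matrix (Fin m ⊕ Fin m) (Fin m ⊕ Fin m) ℂ)ᵀ *
    LieAlgebra.Orthogonal.JD (Fin m) ℂ * (g : Matrix (Fin m ⊕ Fin m) (Fin m ⊕ Fin m) ℂ) =
      LieAlgebra.Orthogonal.JD (Fin m) ℂ}
  one_mem' := by simp
  mul_mem' := by
    intro a b ha hb
    simp only [Set.mem_ofPred_eq, Matrix.SpecialLinearGroup.coe_mul,
      Matrix.transpose_mul] at ha hb ⊢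
    calc _ = (b : Matrix (Fin m ⊕ Fin m) (Fin m ⊕ Fin m) ℂ)ᵀ *
          ((a : Matrix (Fin m ⊕ Fin m) (Fin m ⊕ Fin m) ℂ)ᵀ *
            LieAlgebra.Orthogonal.JD (Fin m) ℂ *
            (a : Matrix (Fin m ⊕ Fin m) (Fin m ⊕ Fin m) ℂ)) *
          (b : Matrix (Fin m ⊕ Fin m) (Fin m ⊕ Fin m) ℂ) := by simp only [Matrix.mul_assoc]
      _ = _ := by rw [ha, hb]
  inv_mem' := by
    intro a ha
    simp only [Set.mem_ofPred_eq] at ha ⊢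
    have h1 : (a : Matrix (Fin m ⊕ Fin m) (Fin m ⊕ Fin m) ℂ) *
        ((a⁻¹ : Matrix.SpecialLinearGroup (Fin m ⊕ Fin m) ℂ) :
          Matrix (Fin m ⊕ Fin m) (Fin m ⊕ Fin m) ℂ) = 1 := by
      rw [← Matrix.SpecialLinearGroup.coe_mul, mul_inv_cancel, Matrix.SpecialLinearGroup.coe_one]
    have h2 := congrArg Matrix.transpose h1
    rw [Matrix.transpose_mul, Matrix.transpose_one] at h2
    nth_rewrite 1 [← ha]
    calc _ = (((a⁻¹ : Matrix.SpecialLinearGroup (Fin m ⊕ Fin m) ℂ) :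
          Matrix (Fin m ⊕ Fin m) (Fin m ⊕ Fin m) ℂ)ᵀ *
            (a : Matrix (Fin m ⊕ Fin m) (Fin m ⊕ Fin m) ℂ)ᵀ) *
            LieAlgebra.Orthogonal.JD (Fin m) ℂ *
            ((a : Matrix (Fin m ⊕ Fin m) (Fin m ⊕ Fin m) ℂ) *
        ((a⁻¹ : Matrix.SpecialLinearGroup (Fin m ⊕ Fin m) ℂ) :
          Matrix (Fin m ⊕ Fin m) (Fin m ⊕ Fin m) ℂ)) := by simp only [Matrix.mul_assoc]
      _ = _ := by rw [h1, h2, Matrix.one_mul, Matrix.mul_one]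

/-- The orbit of `A ∈ 𝔰𝔬_{2m}` under the adjoint action `g ↦ g A g⁻¹` of `SO_{2m}`. -/
def adjointOrbit {m : ℕ} (A : SoLie m) : Set (SoLie m) :=
  {B | ∃ g ∈ SoGroup m, (B : Matrix (Fin m ⊕ Fin m) (Fin m ⊕ Fin m) ℂ) =
    (g : Matrix (Fin m ⊕ Fin m) (Fin m ⊕ Fin m) ℂ) * A *
      ((g⁻¹ : Matrix.SpecialLinearGroup (Fin m ⊕ Fin m) ℂ) :
        Matrix (Fin m ⊕ Fin m) (Fin m ⊕ Fin m) ℂ)}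

/-- The nilpotent Jordan block of size `d`: ones on the superdiagonal, zeros elsewhere. -/
def nilpotentJordanBlock (d : ℕ) : Matrix (Fin d) (Fin d) ℂ :=
  Matrix.of fun i j => if (i : ℕ) + 1 = j then 1 else 0

/-- `A` is nilpotent, and the multiset of the sizes of the blocks of its Jordan normal form
is `d`: after a change of basis, `A` is the block diagonal matrix whose diagonal blocks are the
nilpotent Jordan blocks of sizes `d`. -/
def HasNilpotentJordanType {ι : Type*} [Fintype ι] [DecidableEq ι] (A : Matrix ι ι ℂ)
    (d : Multiset ℕ) : Prop :=
  ∃ l : List ℕ, (l : Multiset ℕ) = d ∧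
    ∃ (e : ((i : Fin l.length) × Fin (l.get i)) ≃ ι) (P : Matrix.GeneralLinearGroup ι ℂ),
      A = (P : Matrix ι ι ℂ) *
        Matrix.reindex e e (Matrix.blockDiagonal' fun i => nilpotentJordanBlock (l.get i)) *
        ((P⁻¹ : Matrix.GeneralLinearGroup ι ℂ) : Matrix ι ι ℂ)

/-- The set of all nilpotent adjoint orbits in `𝔰𝔬_{2m}` that belong to the partition `d`,
that is, the orbits of the nilpotent elements whose Jordan blocks have the sizes `d`. -/
def nilpotentOrbits (m : ℕ) (d : Multiset ℕ) : Set (Set (SoLie m)) :=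
  {O | ∃ A : SoLie m,
    HasNilpotentJordanType (A : Matrix (Fin m ⊕ Fin m) (Fin m ⊕ Fin m) ℂ) d ∧ O = adjointOrbit A}

/-- The partition `[2^a, 1^b]`. -/
def partitionTwoOne (a b : ℕ) : Multiset ℕ :=
  Multiset.replicate a 2 + Multiset.replicate b 1

/-- The Zariski closure of a subset of the affine space `𝔰𝔬_{2m}`: the common zeros of all
polynomials in the matrix entries that vanish on the subset. -/
def zariskiClosure {m : ℕ} (S : Set (SoLie m)) : Set (SoLie m) :=
  {A | ∀ p : MvPolynomial ((Fin m ⊕ Fin m) × (Fin m ⊕ Fin m)) ℂ,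
    (∀ B ∈ S, MvPolynomial.eval
      (fun ij => (B : Matrix (Fin m ⊕ Fin m) (Fin m ⊕ Fin m) ℂ) ij.1 ij.2) p = 0) →
    MvPolynomial.eval
      (fun ij => (A : Matrix (Fin m ⊕ Fin m) (Fin m ⊕ Fin m) ℂ) ij.1 ij.2) p = 0}

/-- The variety `Z = {A ∈ 𝔰𝔬_{2m} | A² = 0, rk A ≤ min {2n, m}}`, with its reduced structure,
that is, as a set of points of the affine space `𝔰𝔬_{2m}`. -/
def varietyZ (n m : ℕ) : Set (SoLie m) :=
  {A | (A : Matrix (Fin m ⊕ Fin m) (Fin m ⊕ Fin m) ℂ) ^ 2 = 0 ∧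
    (A : Matrix (Fin m ⊕ Fin m) (Fin m ⊕ Fin m) ℂ).rank ≤ min (2 * n) m}

/-! The condition `A² = 0` already forces the rank bound. The range lies in the kernel, so the rank
is at most `m`, and skewness makes it even. As `m ≤ 2n + 1`, an even rank `≤ m` is `≤ 2n`, so `Z` is
the set of all square-zero elements. A matrix of size `2a + b` has Jordan type `[2^a, 1^b]` exactly
when it squares to zero and has rank `a`, so everything reduces to sorting square-zero elements by
rank.

Rank classifies them up to the full orthogonal group (`exists_isometry_conj`). A nonzero `A` splits
off a nondegenerate 4-space of fixed shape on which it has rank 2 (`exists_split`), and induction on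
the rank ends at `A = 0`, where nondegenerate complex forms of equal dimension are isometric.
Passing to determinant one depends on the centraliser of `A`. In rank `< m` it contains a reflection
(`exists_orthogonal_commute`), so there is one orbit. In rank `m` it lies in `SO`
(`det_eq_one_of_commute`), so there are two.

For closures, `A² = 0` is a polynomial condition, and each square-zero element is the value at `t =
0` of a continuous curve of elements of maximal even rank (`exists_degeneration`). -/

/-! ### Normal form of a square-zero endomorphism -/

/-- A square-zero endomorphism of rank `r` splits the space as `X × W × X` with `X = ℂ ^ r`, the
endomorphism sending the last copy of `X` identically onto the first. -/
theorem exists_equiv_of_sq_zero {V : Type} [AddCommGroup V] [Module ℂ V] [FiniteDimensional ℂ V]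
    (A : V →ₗ[ℂ] V) (hA : ∀ x, A (A x) = 0) {r c : ℕ}
    (hr : Module.finrank ℂ (LinearMap.range A) = r) (hc : Module.finrank ℂ V = 2 * r + c) :
    ∃ ψ : ((Fin r → ℂ) × (Fin c → ℂ) × (Fin r → ℂ)) ≃ₗ[ℂ] V,
      ∀ x w y, A (ψ (x, w, y)) = ψ (y, 0, 0) := by
  -- With `s` a section of `A` onto its range and `W` a complement of the range inside the kernel,
  -- `V = range ⊕ W ⊕ s(range)`.
  obtain ⟨s, hs⟩ := A.rangeRestrict.exists_rightInverse_of_surjective A.range_rangeRestrict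
  have hs' : ∀ y, A (s y) = y := fun y => congrArg Subtype.val (LinearMap.congr_fun hs y)
  obtain ⟨W, hW⟩ := ((LinearMap.range A).comap (LinearMap.ker A).subtype).exists_isCompl
  have hAr : ∀ x : LinearMap.range A, A x = 0 := by
    rintro ⟨_, z, rfl⟩
    exact hA z
  let f : (LinearMap.range A × W × LinearMap.range A) →ₗ[ℂ] V :=
    (LinearMap.range A).subtype.coprod
      (((LinearMap.ker A).subtype ∘ₗ W.subtype).coprod s)
  have hf : ∀ x w y, f (x, w, y) = x + ((w : LinearMap.ker A) + s y) := fun _ _ _ => rfl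
  have hAf : ∀ x w y, A (f (x, w, y)) = y := by
    intro x w y
    rw [hf, map_add, map_add, hAr, hs', (w : LinearMap.ker A).2, zero_add, zero_add]
  have hinj : Function.Injective f := by
    rw [injective_iff_map_eq_zero]
    rintro ⟨x, w, y⟩ h
    have hy : y = 0 := by
      have := hAf x w y
      rw [h, map_zero] at this
      exact Subtype.ext this.symm
    subst hy
    rw [hf, map_zero, add_zero] at h
    have hw : (w : LinearMap.ker A) = 0 := by
      have h1 : (w : LinearMap.ker A) ∈ (LinearMap.range A).comap (LinearMap.ker A).subtype := by
        rw [Submodule.mem_comap, Submodule.subtype_apply, eq_neg_of_add_eq_zero_right h]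
        exact neg_mem x.2
      exact (Submodule.mem_bot ℂ).1 (hW.disjoint.le_bot ⟨h1, w.2⟩)
    have hw' : w = 0 := Subtype.ext hw
    subst hw'
    have hx : x = 0 := Subtype.ext (by simpa using h)
    rw [hx]
    rfl
  have hsurj : Function.Surjective f := by
    intro v
    have hk : v - s (A.rangeRestrict v) ∈ LinearMap.ker A := by
      rw [LinearMap.mem_ker, map_sub, hs']
      exact sub_self _
    have : (⟨_, hk⟩ : LinearMap.ker A) ∈
        (LinearMap.range A).comap (LinearMap.ker A).subtype ⊔ W := by
      rw [hW.sup_eq_top]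
      trivial
    obtain ⟨x, hx, w, hw, h⟩ := Submodule.mem_sup.1 this
    refine ⟨(⟨x, hx⟩, ⟨w, hw⟩, A.rangeRestrict v), ?_⟩
    have h' : (x : V) + w = v - s (A.rangeRestrict v) := congrArg Subtype.val h
    rw [hf, ← add_assoc]
    exact eq_sub_iff_add_eq.1 h'
  let F := LinearEquiv.ofBijective f ⟨hinj, hsurj⟩
  have hdim := F.finrank_eq
  rw [Module.finrank_prod, Module.finrank_prod, hr, hc] at hdim
  let X : (Fin r → ℂ) ≃ₗ[ℂ] LinearMap.range A := LinearEquiv.ofFinrankEq _ _ (by simp [hr])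
  let Y : (Fin c → ℂ) ≃ₗ[ℂ] W := LinearEquiv.ofFinrankEq _ _ (by
    rw [Module.finrank_fin_fun]
    omega)
  refine ⟨(X.prodCongr (Y.prodCongr X)).trans F, fun x w y => ?_⟩
  have h1 := hAf (X x) (Y w) (X y)
  have h2 := hf (X y) (Y 0) (X 0)
  rw [map_zero, map_zero, map_zero] at h2
  have h3 : f (X y, Y 0, X 0) = X y := by
    rw [map_zero, map_zero, h2]
    simp
  exact h1.trans h3.symm

/-! ### Square-zero skew endomorphisms of quadratic spaces -/

/-- The bilinear form, in coordinates, of a hyperbolic 4-space spanned by `v, w, A v, A w`. -/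
def hyperbolicForm (x y : Fin 4 → ℂ) : ℂ := x 1 * y 2 + x 2 * y 1 - x 0 * y 3 - x 3 * y 0

/-- Skewness makes `B (A x) y` alternating. A hyperbolic pair `v, w` for it, corrected to be
isotropic for `B` and mutually orthogonal, spans with `A v, A w` a nondegenerate `A`-stable 4-space.
`V₁` is its orthogonal complement. -/
theorem exists_split {V : Type} [AddCommGroup V] [Module ℂ V]
    (B : LinearMap.BilinForm ℂ V) (hB : ∀ x y, B x y = B y x) (hn : ∀ x, (∀ y, B x y = 0) → x = 0)
    (A : V →ₗ[ℂ] V) (hs : ∀ x y, B (A x) y = - B x (A y)) (hA : ∀ x, A (A x) = 0)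
    (h0 : A ≠ 0) :
    ∃ (V₁ : Submodule ℂ V) (A₁ : V₁ →ₗ[ℂ] V₁) (ψ : ((Fin 4 → ℂ) × V₁) ≃ₗ[ℂ] V),
      (∀ v : V₁, (A₁ v : V) = A v) ∧
      (∀ x v x' v', B (ψ (x, v)) (ψ (x', v')) = hyperbolicForm x x' + B v v') ∧
      (∀ x v, A (ψ (x, v)) = ψ (![0, 0, x 0, x 1], A₁ v)) := by
  have halt : ∀ x, B (A x) x = 0 := by
    intro x
    have := hs x x
    rw [hB x] at this
    exact self_eq_neg.1 this
  have hAA : ∀ x y, B (A x) (A y) = 0 := by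
    intro x y
    rw [hs, hA, map_zero, neg_zero]
  obtain ⟨v, w, hvv, hww, hvw, h1⟩ : ∃ v w, B v v = 0 ∧ B w w = 0 ∧ B v w = 0 ∧
      B (A v) w = 1 := by
    obtain ⟨v, hv⟩ : ∃ v, A v ≠ 0 := by
      by_contra! h
      exact h0 (LinearMap.ext h)
    obtain ⟨w, hw⟩ : ∃ w, B (A v) w ≠ 0 := by
      by_contra! h
      exact hv (hn _ h)
    set w₁ := (B (A v) w)⁻¹ • w with hw₁
    have e1 : B (A v) w₁ = 1 := by
      rw [hw₁, map_smul, smul_eq_mul, inv_mul_cancel₀ hw]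
    have e2 : B w₁ (A v) = 1 := by rw [hB, e1]
    have e3 : B v (A w₁) = -1 := by
      have := hs v w₁
      rw [e1] at this
      rw [this, neg_neg]
    have e4 : B (A w₁) v = -1 := by rw [hB, e3]
    have e5 : ∀ x, B x (A x) = 0 := fun x => by rw [hB, halt]
    -- The corrections lie in the range of `A`. They leave `A v`, `A w₁` and `B (A v) w₁ = 1`
    -- unchanged, and their coefficients cancel `B v v`, `B w₁ w₁` and `B v w₁`.
    refine ⟨v + (B v v / 2) • A w₁ - B v w₁ • A v, w₁ - (B w₁ w₁ / 2) • A v, ?_, ?_, ?_, ?_⟩ <;>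
    simp only [map_add, map_sub, map_smul, LinearMap.add_apply, LinearMap.sub_apply,
      LinearMap.smul_apply, smul_eq_mul, hAA, halt, e5, hA, e1, e2, e3, e4, smul_zero] <;> ring
  have h2 : B w (A v) = 1 := by rw [hB, h1]
  have h3 : B v (A w) = -1 := by
    have := hs v w
    rw [h1] at this
    rw [this, neg_neg]
  have h4 : B (A w) v = -1 := by rw [hB, h3]
  have hwv : B w v = 0 := by rw [hB, hvw]
  have e5 : ∀ x, B x (A x) = 0 := fun x => by rw [hB, halt]
  let s : (Fin 4 → ℂ) →ₗ[ℂ] V :=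
    (LinearMap.proj 0).smulRight v + (LinearMap.proj 1).smulRight w +
      (LinearMap.proj 2).smulRight (A v) + (LinearMap.proj 3).smulRight (A w)
  have hsx : ∀ x, s x = x 0 • v + x 1 • w + x 2 • A v + x 3 • A w := fun _ => rfl
  -- Pairing with the dual basis reads off the coordinates of `s`, so `c` retracts `s` and `ker c`
  -- is the orthogonal complement of its image.
  let c : V →ₗ[ℂ] (Fin 4 → ℂ) := LinearMap.pi ![-B (A w), B (A v), B w, -B v]
  have hc : ∀ y, c y = ![-B (A w) y, B (A v) y, B w y, -B v y] := by
    intro y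
    ext i
    fin_cases i <;> rfl
  have hcs : ∀ x, c (s x) = x := by
    intro x
    rw [hc, hsx]
    ext i
    fin_cases i <;> simp [hvv, hww, hvw, hwv, h1, h2, h3, h4, halt, hAA, e5]
  let V₁ := LinearMap.ker c
  have hV : ∀ y : V₁, B v y = 0 ∧ B w y = 0 ∧ B (A v) y = 0 ∧ B (A w) y = 0 := by
    intro y
    have h := (hc y).symm.trans y.2
    have i0 := congrFun h 0
    have i1 := congrFun h 1
    have i2 := congrFun h 2
    have i3 := congrFun h 3
    simp at i0 i1 i2 i3
    exact ⟨i3, i2, i1, i0⟩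
  have hinv : ∀ y ∈ V₁, A y ∈ V₁ := by
    intro y hy
    obtain ⟨q1, q2, q3, q4⟩ := hV ⟨y, hy⟩
    simp only [] at q1 q2 q3 q4
    rw [LinearMap.mem_ker, hc, hAA, hAA]
    have r1 := hs v y
    have r2 := hs w y
    rw [q3] at r1
    rw [q4] at r2
    rw [neg_eq_zero.1 r1.symm, neg_eq_zero.1 r2.symm]
    simp
  let ψ₀ : ((Fin 4 → ℂ) × V₁) →ₗ[ℂ] V := s.coprod V₁.subtype
  have hψ : ∀ x y, ψ₀ (x, y) = s x + y := fun _ _ => rfl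
  have hb : Function.Bijective ψ₀ := by
    constructor
    · rw [injective_iff_map_eq_zero]
      rintro ⟨x, y⟩ h
      rw [hψ] at h
      have hx : x = 0 := by
        have := congrArg c h
        rwa [map_add, hcs, LinearMap.mem_ker.1 y.2, add_zero, map_zero] at this
      subst hx
      rw [map_zero, zero_add] at h
      rw [Prod.mk_eq_zero]
      exact ⟨rfl, Subtype.ext h⟩
    · intro y
      refine ⟨(c y, ⟨y - s (c y), ?_⟩), ?_⟩
      · rw [LinearMap.mem_ker, map_sub, hcs, sub_self]
      · rw [hψ]
        exact add_sub_cancel _ _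
  refine ⟨V₁, A.restrict hinv, LinearEquiv.ofBijective ψ₀ hb, fun _ => rfl, ?_, ?_⟩
  · intro x y x' y'
    obtain ⟨q1, q2, q3, q4⟩ := hV y
    obtain ⟨p1, p2, p3, p4⟩ := hV y'
    change B (ψ₀ (x, y)) (ψ₀ (x', y')) = _
    rw [hψ, hψ, hsx, hsx]
    have z1 : B y v = 0 := by rw [hB, q1]
    have z2 : B y w = 0 := by rw [hB, q2]
    have z3 : B y (A v) = 0 := by rw [hB, q3]
    have z4 : B y (A w) = 0 := by rw [hB, q4]
    simp only [map_add, map_smul, LinearMap.add_apply, LinearMap.smul_apply, smul_eq_mul,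
      hvv, hww, hvw, hwv, h1, h2, h3, h4, halt, hAA, e5, p1, p2, p3, p4, z1, z2, z3, z4,
      hyperbolicForm]
    ring
  · intro x y
    change A (ψ₀ (x, y)) = ψ₀ (_, _)
    rw [hψ, hψ, hsx, hsx]
    simp [hA, LinearMap.restrict_apply]

/-- A product of submodules is isomorphic to the product of the underlying modules. -/
def prodSubmoduleEquiv {V W : Type} [AddCommGroup V] [Module ℂ V] [AddCommGroup W] [Module ℂ W]
    (p : Submodule ℂ V) (q : Submodule ℂ W) : p.prod q ≃ₗ[ℂ] p × q where
  toFun x := (⟨x.1.1, x.2.1⟩, ⟨x.1.2, x.2.2⟩)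
  invFun y := ⟨(y.1, y.2), y.1.2, y.2.2⟩
  map_add' _ _ := rfl
  map_smul' _ _ := rfl
  left_inv _ := rfl
  right_inv _ := rfl

theorem finrank_range_of_split {V V₁ : Type} [AddCommGroup V] [Module ℂ V]
    [AddCommGroup V₁] [Module ℂ V₁] [FiniteDimensional ℂ V₁]
    (A : V →ₗ[ℂ] V) (A₁ : V₁ →ₗ[ℂ] V₁) (ψ : ((Fin 4 → ℂ) × V₁) ≃ₗ[ℂ] V)
    (h : ∀ x v, A (ψ (x, v)) = ψ (![0, 0, x 0, x 1], A₁ v)) :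
    Module.finrank ℂ (LinearMap.range A) = 2 + Module.finrank ℂ (LinearMap.range A₁) := by
  let N : (Fin 4 → ℂ) →ₗ[ℂ] (Fin 4 → ℂ) :=
    LinearMap.pi ![0, 0, LinearMap.proj 0, LinearMap.proj 1]
  have hN : ∀ x, N x = ![0, 0, x 0, x 1] := by
    intro x
    ext i
    fin_cases i <;> rfl
  have hA : A = ψ.toLinearMap ∘ₗ N.prodMap A₁ ∘ₗ ψ.symm.toLinearMap := by
    ext v
    obtain ⟨⟨x, y⟩, rfl⟩ := ψ.surjective v
    simp [h, hN]
  have hrN : Module.finrank ℂ (LinearMap.range N) = 2 := by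
    have e : LinearMap.range N = LinearMap.range (LinearMap.pi
        ![0, 0, LinearMap.proj 0, LinearMap.proj 1] : (Fin 2 → ℂ) →ₗ[ℂ] (Fin 4 → ℂ)) := by
      ext z
      constructor
      · rintro ⟨x, rfl⟩
        refine ⟨![x 0, x 1], ?_⟩
        ext i
        fin_cases i <;> rfl
      · rintro ⟨x, rfl⟩
        refine ⟨![x 0, x 1, 0, 0], ?_⟩
        ext i
        fin_cases i <;> rfl
    rw [e, LinearMap.finrank_range_of_inj]
    · simp
    · intro x y hxy
      ext i
      fin_cases i
      · exact congrFun hxy 2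
      · exact congrFun hxy 3
  rw [hA, LinearMap.range_comp, LinearMap.range_comp_of_range_eq_top _ ψ.symm.range,
    LinearEquiv.finrank_map_eq, LinearMap.range_prodMap,
    (prodSubmoduleEquiv _ _).finrank_eq, Module.finrank_prod, hrN]

/-- Supplies the induction hypotheses for `V₁`; nondegeneracy passes down because the sum is
orthogonal. -/
theorem split_inherits {V : Type} [AddCommGroup V] [Module ℂ V]
    (B : LinearMap.BilinForm ℂ V) (hB : ∀ x y, B x y = B y x) (hn : ∀ x, (∀ y, B x y = 0) → x = 0)
    (A : V →ₗ[ℂ] V) (hs : ∀ x y, B (A x) y = - B x (A y)) (hA : ∀ x, A (A x) = 0)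
    {V₁ : Submodule ℂ V} (A₁ : V₁ →ₗ[ℂ] V₁) (ψ : ((Fin 4 → ℂ) × V₁) ≃ₗ[ℂ] V)
    (h1 : ∀ v : V₁, (A₁ v : V) = A v)
    (h2 : ∀ x v x' v', B (ψ (x, v)) (ψ (x', v')) = hyperbolicForm x x' + B v v') :
    (∀ x y, B.restrict V₁ x y = B.restrict V₁ y x) ∧
    (∀ x, (∀ y, B.restrict V₁ x y = 0) → x = 0) ∧
    (∀ x y, B.restrict V₁ (A₁ x) y = - B.restrict V₁ x (A₁ y)) ∧ ∀ x, A₁ (A₁ x) = 0 := by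
  refine ⟨fun x y => hB _ _, fun x hx => ?_, fun x y => ?_, fun x => ?_⟩
  · have : ψ (0, x) = 0 := by
      refine hn _ fun y => ?_
      obtain ⟨⟨y, w⟩, rfl⟩ := ψ.surjective y
      rw [h2]
      simpa [hyperbolicForm] using hx w
    simpa using this
  · change B (A₁ x : V) y = - B x (A₁ y : V)
    rw [h1, h1, hs]
  · exact Subtype.ext (by rw [h1, h1, hA]; rfl)

/-- Nondegenerate quadratic forms of one dimension over an algebraically closed field are
equivalent. `C` is pulled back along any linear isomorphism, and polarisation returns to bilinear
forms. -/
theorem exists_isometry {V W : Type} [AddCommGroup V] [Module ℂ V] [FiniteDimensional ℂ V]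
    [AddCommGroup W] [Module ℂ W] [FiniteDimensional ℂ W]
    (B : LinearMap.BilinForm ℂ V) (hB : ∀ x y, B x y = B y x) (hn : ∀ x, (∀ y, B x y = 0) → x = 0)
    (C : LinearMap.BilinForm ℂ W) (hC : ∀ x y, C x y = C y x) (hm : ∀ x, (∀ y, C x y = 0) → x = 0)
    (hd : Module.finrank ℂ V = Module.finrank ℂ W) :
    ∃ φ : V ≃ₗ[ℂ] W, ∀ x y, C (φ x) (φ y) = B x y := by
  let e : V ≃ₗ[ℂ] W := LinearEquiv.ofFinrankEq _ _ hd
  let D : LinearMap.BilinForm ℂ V := C.compl₁₂ e.toLinearMap e.toLinearMap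
  have hD : ∀ x y, D x y = C (e x) (e y) := fun _ _ => rfl
  have key : ∀ E : LinearMap.BilinForm ℂ V, (∀ x y, E x y = E y x) →
      QuadraticMap.associated (R := ℂ) (LinearMap.BilinMap.toQuadraticMap E) = E := by
    intro E hE
    exact QuadraticMap.associated_left_inverse ℂ hE
  obtain ⟨φ⟩ := QuadraticForm.equivalent_of_isAlgClosed
    (LinearMap.BilinMap.toQuadraticMap B) (LinearMap.BilinMap.toQuadraticMap D)
    (by
      rw [key B hB]
      exact hn)
    (by
      rw [key D fun x y => hC _ _]
      intro x hx
      refine e.map_eq_zero_iff.1 (hm _ fun y => ?_)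
      obtain ⟨y, rfl⟩ := e.surjective y
      exact hx y)
  have hq : ∀ x, C (e (φ x)) (e (φ x)) = B x x := fun x => φ.map_app x
  refine ⟨φ.toLinearEquiv.trans e, fun x y => ?_⟩
  change C (e (φ.toLinearEquiv x)) (e (φ.toLinearEquiv y)) = B x y
  have hq' : ∀ x, C (e (φ.toLinearEquiv x)) (e (φ.toLinearEquiv x)) = B x x := hq
  have h := hq' (x + y)
  simp only [map_add, LinearMap.add_apply, hq', hB y x,
    hC (e (φ.toLinearEquiv y)) (e (φ.toLinearEquiv x))] at h
  linear_combination h / 2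

/-- Square-zero skew-adjoint endomorphisms of nondegenerate complex quadratic spaces have even
rank. -/
theorem even_finrank_range_of_skew {V : Type} [AddCommGroup V] [Module ℂ V]
    [FiniteDimensional ℂ V] (B : LinearMap.BilinForm ℂ V) (hB : ∀ x y, B x y = B y x)
    (hn : ∀ x, (∀ y, B x y = 0) → x = 0)
    (A : V →ₗ[ℂ] V) (hs : ∀ x y, B (A x) y = - B x (A y)) (hA : ∀ x, A (A x) = 0) :
    Even (Module.finrank ℂ (LinearMap.range A)) := by
  induction hr : Module.finrank ℂ (LinearMap.range A) using Nat.strong_induction_on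
    generalizing V with
  | _ r ih =>
  by_cases h0 : A = 0
  · subst h0
    rw [LinearMap.range_zero, finrank_bot] at hr
    simp [← hr]
  obtain ⟨V₁, A₁, ψ, h1, h2, h3⟩ := exists_split B hB hn A hs hA h0
  obtain ⟨g1, g2, g3, g4⟩ := split_inherits B hB hn A hs hA A₁ ψ h1 h2
  have := finrank_range_of_split A A₁ ψ h3
  rw [← hr, this]
  exact even_two.add (ih _ (by omega) (B.restrict V₁) g1 g2 A₁ g3 g4 rfl)

/-- A square-zero skew-adjoint endomorphism of a nondegenerate complex quadratic space is
determined up to isometry by its rank and the dimension of the space. -/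
theorem exists_isometry_conj {V W : Type} [AddCommGroup V] [Module ℂ V] [FiniteDimensional ℂ V]
    [AddCommGroup W] [Module ℂ W] [FiniteDimensional ℂ W]
    (B : LinearMap.BilinForm ℂ V) (hB : ∀ x y, B x y = B y x) (hn : ∀ x, (∀ y, B x y = 0) → x = 0)
    (A : V →ₗ[ℂ] V) (hs : ∀ x y, B (A x) y = - B x (A y)) (hA : ∀ x, A (A x) = 0)
    (C : LinearMap.BilinForm ℂ W) (hC : ∀ x y, C x y = C y x) (hm : ∀ x, (∀ y, C x y = 0) → x = 0)
    (A' : W →ₗ[ℂ] W) (hs' : ∀ x y, C (A' x) y = - C x (A' y)) (hA' : ∀ x, A' (A' x) = 0)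
    (hd : Module.finrank ℂ V = Module.finrank ℂ W)
    (hr : Module.finrank ℂ (LinearMap.range A) = Module.finrank ℂ (LinearMap.range A')) :
    ∃ φ : V ≃ₗ[ℂ] W, (∀ x y, C (φ x) (φ y) = B x y) ∧ ∀ x, φ (A x) = A' (φ x) := by
  induction hk : Module.finrank ℂ (LinearMap.range A) using Nat.strong_induction_on
    generalizing V W with
  | _ r ih =>
  by_cases h0 : A = 0
  · have h0' : A' = 0 := by
      rw [h0, LinearMap.range_zero, finrank_bot] at hr
      exact LinearMap.range_eq_bot.1 (Submodule.finrank_eq_zero.1 hr.symm)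
    obtain ⟨φ, hφ⟩ := exists_isometry B hB hn C hC hm hd
    exact ⟨φ, hφ, fun x => by simp [h0, h0']⟩
  have h0' : A' ≠ 0 := by
    rintro h0'
    rw [h0', LinearMap.range_zero, finrank_bot] at hr
    exact h0 (LinearMap.range_eq_bot.1 (Submodule.finrank_eq_zero.1 hr))
  obtain ⟨V₁, A₁, ψ, h1, h2, h3⟩ := exists_split B hB hn A hs hA h0
  obtain ⟨g1, g2, g3, g4⟩ := split_inherits B hB hn A hs hA A₁ ψ h1 h2
  obtain ⟨W₁, A₁', χ, k1, k2, k3⟩ := exists_split C hC hm A' hs' hA' h0'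
  obtain ⟨l1, l2, l3, l4⟩ := split_inherits C hC hm A' hs' hA' A₁' χ k1 k2
  have r1 := finrank_range_of_split A A₁ ψ h3
  have r2 := finrank_range_of_split A' A₁' χ k3
  have d1 := ψ.finrank_eq
  have d2 := χ.finrank_eq
  rw [Module.finrank_prod] at d1 d2
  obtain ⟨φ, p1, p2⟩ := ih _ (by omega) (B.restrict V₁) g1 g2 A₁ g3 g4 (C.restrict W₁) l1 l2 A₁'
    l3 l4 (by omega) (by omega) rfl
  have hφ : ∀ x v, ((ψ.symm.trans ((LinearEquiv.refl ℂ _).prodCongr φ)).trans χ) (ψ (x, v)) =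
      χ (x, φ v) := by
    intro x v
    simp
  refine ⟨(ψ.symm.trans ((LinearEquiv.refl ℂ _).prodCongr φ)).trans χ, ?_, ?_⟩
  · intro x y
    obtain ⟨⟨x, v⟩, rfl⟩ := ψ.surjective x
    obtain ⟨⟨y, w⟩, rfl⟩ := ψ.surjective y
    rw [hφ, hφ, h2, k2]
    congr 1
    exact p1 v w
  · intro x
    obtain ⟨⟨x, v⟩, rfl⟩ := ψ.surjective x
    rw [h3, hφ, hφ, k3, p2]

-- Orthogonal matrices and the form on coordinates

local notation "𝐉" => LieAlgebra.Orthogonal.JD (Fin _) ℂ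

theorem JD_mul_self (m : ℕ) : LieAlgebra.Orthogonal.JD (Fin m) ℂ *
    LieAlgebra.Orthogonal.JD (Fin m) ℂ = 1 := by
  simp [LieAlgebra.Orthogonal.JD, fromBlocks_multiply]

theorem JD_transpose (m : ℕ) : (LieAlgebra.Orthogonal.JD (Fin m) ℂ)ᵀ =
    LieAlgebra.Orthogonal.JD (Fin m) ℂ := by
  simp [LieAlgebra.Orthogonal.JD, fromBlocks_transpose]

theorem mem_SoLie_iff {m : ℕ} (A : Matrix (Fin m ⊕ Fin m) (Fin m ⊕ Fin m) ℂ) :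
    A ∈ SoLie m ↔ Aᵀ * 𝐉 = -(𝐉 * A) := by
  rw [SoLie, LieAlgebra.Orthogonal.typeD, mem_skewAdjointMatricesLieSubalgebra,
    mem_skewAdjointMatricesSubmodule, Matrix.IsSkewAdjoint, Matrix.IsAdjointPair, mul_neg]

theorem det_of_orthogonal {m : ℕ} {g : Matrix (Fin m ⊕ Fin m) (Fin m ⊕ Fin m) ℂ}
    (hg : gᵀ * 𝐉 * g = 𝐉) : g.det = 1 ∨ g.det = -1 := by
  have hJ : (LieAlgebra.Orthogonal.JD (Fin m) ℂ).det ≠ 0 := by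
    intro h
    have := congrArg Matrix.det (JD_mul_self m)
    rw [det_mul, h, det_one] at this
    simp at this
  have h := congrArg Matrix.det hg
  rw [det_mul, det_mul, det_transpose] at h
  rw [← sq_eq_one_iff]
  exact mul_right_cancel₀ hJ (by linear_combination h)

theorem isUnit_det_of_orthogonal {m : ℕ} {g : Matrix (Fin m ⊕ Fin m) (Fin m ⊕ Fin m) ℂ}
    (hg : gᵀ * 𝐉 * g = 𝐉) : IsUnit g.det := by
  rcases det_of_orthogonal hg with h | h <;> simp [h]

theorem orthogonal_mul {m : ℕ} {g h : Matrix (Fin m ⊕ Fin m) (Fin m ⊕ Fin m) ℂ}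
    (hg : gᵀ * 𝐉 * g = 𝐉) (hh : hᵀ * 𝐉 * h = 𝐉) : (g * h)ᵀ * 𝐉 * (g * h) = 𝐉 := by
  calc (g * h)ᵀ * 𝐉 * (g * h) = hᵀ * (gᵀ * 𝐉 * g) * h := by
        rw [transpose_mul]
        simp only [Matrix.mul_assoc]
    _ = 𝐉 := by rw [hg, hh]

theorem orthogonal_inv {m : ℕ} {g : Matrix (Fin m ⊕ Fin m) (Fin m ⊕ Fin m) ℂ}
    (hg : gᵀ * 𝐉 * g = 𝐉) : (g⁻¹)ᵀ * 𝐉 * g⁻¹ = 𝐉 := by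
  have h1 : g * g⁻¹ = 1 := mul_nonsing_inv g (isUnit_det_of_orthogonal hg)
  have h2 : (g⁻¹)ᵀ * gᵀ = 1 := by rw [← transpose_mul, h1, transpose_one]
  calc (g⁻¹)ᵀ * 𝐉 * g⁻¹ = (g⁻¹)ᵀ * (gᵀ * 𝐉 * g) * g⁻¹ := by rw [hg]
    _ = ((g⁻¹)ᵀ * gᵀ) * 𝐉 * (g * g⁻¹) := by simp only [Matrix.mul_assoc]
    _ = 𝐉 := by rw [h1, h2, Matrix.one_mul, Matrix.mul_one]

/-- The intertwining form `g * A = B * g` avoids inverses in the special linear group from here on.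
-/
theorem mem_adjointOrbit_iff {m : ℕ} (A B : SoLie m) :
    B ∈ adjointOrbit A ↔ ∃ g : Matrix (Fin m ⊕ Fin m) (Fin m ⊕ Fin m) ℂ, g.det = 1 ∧
      gᵀ * 𝐉 * g = 𝐉 ∧ g * A = B * g := by
  have key : ∀ g : Matrix.SpecialLinearGroup (Fin m ⊕ Fin m) ℂ,
      ((g⁻¹ : Matrix.SpecialLinearGroup (Fin m ⊕ Fin m) ℂ) :
        Matrix (Fin m ⊕ Fin m) (Fin m ⊕ Fin m) ℂ) *
        (g : Matrix (Fin m ⊕ Fin m) (Fin m ⊕ Fin m) ℂ) = 1 ∧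
      (g : Matrix (Fin m ⊕ Fin m) (Fin m ⊕ Fin m) ℂ) *
      ((g⁻¹ : Matrix.SpecialLinearGroup (Fin m ⊕ Fin m) ℂ) :
        Matrix (Fin m ⊕ Fin m) (Fin m ⊕ Fin m) ℂ) = 1 := by
    intro g
    exact ⟨congrArg Subtype.val (inv_mul_cancel g), congrArg Subtype.val (mul_inv_cancel g)⟩
  constructor
  · rintro ⟨g, hg, h⟩
    refine ⟨g, g.2, hg, ?_⟩
    rw [h, Matrix.mul_assoc, (key g).1, Matrix.mul_one]
  · rintro ⟨g, hd, hg, h⟩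
    refine ⟨⟨g, hd⟩, hg, ?_⟩
    have := (key ⟨g, hd⟩).2
    simp only [h]
    rw [Matrix.mul_assoc]
    exact (by rw [this, Matrix.mul_one])

theorem eq_of_dotProduct_mulVec {ι : Type} [Fintype ι] [DecidableEq ι] {M N : Matrix ι ι ℂ}
    (h : ∀ x y, x ⬝ᵥ M *ᵥ y = x ⬝ᵥ N *ᵥ y) : M = N := by
  ext i j
  simpa using h (Pi.single i 1) (Pi.single j 1)

section Form
variable {m : ℕ}

theorem toBilin'_JD_apply (x y : Fin m ⊕ Fin m → ℂ) :
    Matrix.toBilin' (LieAlgebra.Orthogonal.JD (Fin m) ℂ) x y = x ⬝ᵥ 𝐉 *ᵥ y :=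
  Matrix.toBilin'_apply' _ _ _

theorem toBilin'_JD_symm (x y : Fin m ⊕ Fin m → ℂ) :
    Matrix.toBilin' (LieAlgebra.Orthogonal.JD (Fin m) ℂ) x y =
    Matrix.toBilin' (LieAlgebra.Orthogonal.JD (Fin m) ℂ) y x := by
  rw [toBilin'_JD_apply, toBilin'_JD_apply, dotProduct_comm, dotProduct_mulVec,
    ← mulVec_transpose, JD_transpose, dotProduct_comm, dotProduct_comm]

theorem toBilin'_JD_separating (x : Fin m ⊕ Fin m → ℂ)
    (h : ∀ y, Matrix.toBilin' (LieAlgebra.Orthogonal.JD (Fin m) ℂ) x y = 0) : x = 0 := by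
  refine dotProduct_eq_zero x fun z => ?_
  have := h (𝐉 *ᵥ z)
  rwa [toBilin'_JD_apply, mulVec_mulVec, JD_mul_self, one_mulVec] at this

theorem toBilin'_JD_skew {A : Matrix (Fin m ⊕ Fin m) (Fin m ⊕ Fin m) ℂ}
    (hA : Aᵀ * 𝐉 = -(𝐉 * A)) (x y : Fin m ⊕ Fin m → ℂ) :
    Matrix.toBilin' (LieAlgebra.Orthogonal.JD (Fin m) ℂ) (A *ᵥ x) y =
    - Matrix.toBilin' (LieAlgebra.Orthogonal.JD (Fin m) ℂ) x (A *ᵥ y) := by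
  rw [toBilin'_JD_apply, toBilin'_JD_apply, ← vecMul_transpose, ← dotProduct_mulVec,
    mulVec_mulVec, hA, mulVec_mulVec, neg_mulVec, dotProduct_neg]

theorem mulVecLin_mulVecLin_eq_zero {ι : Type} [Fintype ι] [DecidableEq ι] {A : Matrix ι ι ℂ}
    (hA : A * A = 0) (x : ι → ℂ) : A.mulVecLin (A.mulVecLin x) = 0 := by
  rw [mulVecLin_apply, mulVecLin_apply, mulVec_mulVec, hA, zero_mulVec]

theorem exists_orthogonal_conj {A B : Matrix (Fin m ⊕ Fin m) (Fin m ⊕ Fin m) ℂ}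
    (hs : Aᵀ * 𝐉 = -(𝐉 * A)) (ht : Bᵀ * 𝐉 = -(𝐉 * B))
    (hA : A * A = 0) (hB : B * B = 0) (h : A.rank = B.rank) :
    ∃ g : Matrix (Fin m ⊕ Fin m) (Fin m ⊕ Fin m) ℂ, gᵀ * 𝐉 * g = 𝐉 ∧ g * A = B * g := by
  obtain ⟨φ, h1, h2⟩ := exists_isometry_conj
    (Matrix.toBilin' (LieAlgebra.Orthogonal.JD (Fin m) ℂ)) toBilin'_JD_symm toBilin'_JD_separating
    A.mulVecLin (toBilin'_JD_skew hs) (mulVecLin_mulVecLin_eq_zero hA)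
    (Matrix.toBilin' (LieAlgebra.Orthogonal.JD (Fin m) ℂ)) toBilin'_JD_symm toBilin'_JD_separating
    B.mulVecLin (toBilin'_JD_skew ht) (mulVecLin_mulVecLin_eq_zero hB) rfl h
  have hφ : ∀ x, φ x = LinearMap.toMatrix' φ.toLinearMap *ᵥ x := fun x =>
    (LinearMap.toMatrix'_mulVec φ.toLinearMap x).symm
  refine ⟨LinearMap.toMatrix' φ.toLinearMap, ?_, ?_⟩
  · refine eq_of_dotProduct_mulVec fun x y => ?_
    have := h1 x y
    rw [toBilin'_JD_apply, toBilin'_JD_apply, hφ, hφ, ← vecMul_transpose,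
      ← dotProduct_mulVec, mulVec_mulVec, mulVec_mulVec] at this
    rw [this]
  · refine eq_of_dotProduct_mulVec fun x y => ?_
    have := h2 y
    rw [hφ, mulVecLin_apply, mulVecLin_apply, hφ y, mulVec_mulVec, mulVec_mulVec] at this
    rw [this]

theorem even_rank_of_skew {A : Matrix (Fin m ⊕ Fin m) (Fin m ⊕ Fin m) ℂ}
    (hs : Aᵀ * 𝐉 = -(𝐉 * A)) (hA : A * A = 0) : Even A.rank :=
  even_finrank_range_of_skew
    (Matrix.toBilin' (LieAlgebra.Orthogonal.JD (Fin m) ℂ)) toBilin'_JD_symm toBilin'_JD_separating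
    A.mulVecLin (toBilin'_JD_skew hs) (mulVecLin_mulVecLin_eq_zero hA)

end Form

/-! ### Rank bound and centralising reflections -/

theorem two_mul_rank_le {ι : Type} [Fintype ι] [DecidableEq ι] (A : Matrix ι ι ℂ)
    (hA : A * A = 0) : 2 * A.rank ≤ Fintype.card ι := by
  have h1 := A.mulVecLin.finrank_range_add_finrank_ker
  rw [Module.finrank_fintype_fun_eq_card] at h1
  have h2 : LinearMap.range A.mulVecLin ≤ LinearMap.ker A.mulVecLin := by
    rintro _ ⟨x, rfl⟩
    simp [hA]
  have := Submodule.finrank_mono h2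
  rw [Matrix.rank]
  omega

/-- If `A` has rank less than `m`, then some orthogonal matrix of determinant `-1` commutes
with `A`: a reflection in an anisotropic vector of the kernel. -/
theorem exists_orthogonal_commute {m : ℕ} {A : Matrix (Fin m ⊕ Fin m) (Fin m ⊕ Fin m) ℂ}
    (hs : Aᵀ * 𝐉 = -(𝐉 * A)) (hr : A.rank < m) :
    ∃ g : Matrix (Fin m ⊕ Fin m) (Fin m ⊕ Fin m) ℂ, gᵀ * 𝐉 * g = 𝐉 ∧ g.det = -1 ∧
      g * A = A * g := by
  obtain ⟨v, hv, hvv⟩ : ∃ v, A *ᵥ v = 0 ∧ v ⬝ᵥ 𝐉 *ᵥ v ≠ 0 := by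
    -- If every kernel vector were isotropic, the kernel would be totally isotropic by polarisation,
    -- hence of dimension at most `m`, against `rank < m`.
    by_contra! hcon
    have hcon' : ∀ v w, A *ᵥ v = 0 → A *ᵥ w = 0 → v ⬝ᵥ 𝐉 *ᵥ w = 0 := by
      intro v w hv hw
      have h1 := hcon (v + w) (by rw [mulVec_add, hv, hw, add_zero])
      have h2 := toBilin'_JD_symm v w
      rw [toBilin'_JD_apply, toBilin'_JD_apply] at h2
      rw [mulVec_add, add_dotProduct, dotProduct_add, dotProduct_add, hcon v hv, hcon w hw,
        ← h2] at h1
      linear_combination h1 / 2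
    have hB : (Matrix.toBilin' (LieAlgebra.Orthogonal.JD (Fin m) ℂ)).Nondegenerate := by
      refine ⟨toBilin'_JD_separating, fun x hx => toBilin'_JD_separating x fun y => ?_⟩
      rw [toBilin'_JD_symm, hx]
    have h1 := LinearMap.BilinForm.finrank_orthogonal hB (LinearMap.ker A.mulVecLin)
    have h2 : LinearMap.ker A.mulVecLin ≤
        (Matrix.toBilin' (LieAlgebra.Orthogonal.JD (Fin m) ℂ)).orthogonal
          (LinearMap.ker A.mulVecLin) := by
      intro w hw v hv
      change Matrix.toBilin' (LieAlgebra.Orthogonal.JD (Fin m) ℂ) v w = 0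
      rw [toBilin'_JD_apply]
      exact hcon' v w hv hw
    have h3 := Submodule.finrank_mono h2
    have h4 := A.mulVecLin.finrank_range_add_finrank_ker
    rw [Module.finrank_fintype_fun_eq_card] at h1 h4
    rw [Matrix.rank] at hr
    simp at h1 h4
    omega
  set b := v ⬝ᵥ 𝐉 *ᵥ v with hb
  set u := 𝐉 *ᵥ v with hu
  have hJv : vecMulVec u v * 𝐉 = vecMulVec u u := by
    rw [vecMulVec_mul, ← mulVec_transpose, JD_transpose]
  have hJv' : 𝐉 * vecMulVec v u = vecMulVec u u := by
    rw [mul_vecMulVec]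
  have huA : u ᵥ* A = 0 := by
    have : Aᵀ *ᵥ (𝐉 *ᵥ v) = 0 := by
      rw [mulVec_mulVec, hs, neg_mulVec, ← mulVec_mulVec, hv, mulVec_zero, neg_zero]
    rw [← mulVec_transpose]
    exact this
  -- The reflection `x ↦ x - 2 (B v x / B v v) v`. It commutes with `A` because `A v = 0` and, by
  -- skewness, the range of `A` is orthogonal to `v`.
  refine ⟨1 + vecMulVec ((-2 / b) • v) u, ?_, ?_, ?_⟩
  · rw [transpose_add, transpose_one, transpose_vecMulVec, vecMulVec_smul, smul_vecMulVec,
      Matrix.add_mul, Matrix.one_mul, Matrix.smul_mul, hJv, Matrix.add_mul, Matrix.mul_add,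
      Matrix.mul_add, Matrix.mul_one, Matrix.mul_one, Matrix.mul_smul, hJv', Matrix.smul_mul,
      Matrix.mul_smul, vecMulVec_mul_vecMulVec, dotProduct_comm u v, ← hb]
    rw [vecMulVec_smul]
    have hc : (-2 / b) + ((-2 / b) + (-2 / b) * (-2 / b) * b) = 0 := by
      field_simp
      ring
    rw [smul_smul, smul_smul, add_assoc, ← add_smul, ← add_smul, hc, zero_smul, add_zero]
  · rw [vecMulVec_eq Unit, det_one_add_replicateCol_mul_replicateRow, dotProduct_smul,
      dotProduct_comm, ← hb, smul_eq_mul]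
    field_simp
    ring
  · rw [Matrix.add_mul, Matrix.one_mul, Matrix.mul_add, Matrix.mul_one, vecMulVec_mul,
      mul_vecMulVec, huA, mulVec_smul, hv]
    simp

/-! ### Jordan type `[2^a, 1^b]` in terms of rank -/

theorem exists_conj_of_sq_zero {ι : Type} [Fintype ι] [DecidableEq ι] {A B : Matrix ι ι ℂ}
    (hA : A * A = 0) (hB : B * B = 0) (h : A.rank = B.rank) :
    ∃ P : Matrix.GeneralLinearGroup ι ℂ, A = (P : Matrix ι ι ℂ) * B *
      ((P⁻¹ : Matrix.GeneralLinearGroup ι ℂ) : Matrix ι ι ℂ) := by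
  have hc : Module.finrank ℂ (ι → ℂ) = 2 * A.rank + (Fintype.card ι - 2 * A.rank) := by
    have := two_mul_rank_le A hA
    rw [Module.finrank_fintype_fun_eq_card]
    omega
  obtain ⟨ψ, hψ⟩ := exists_equiv_of_sq_zero (r := A.rank) A.mulVecLin
    (mulVecLin_mulVecLin_eq_zero hA) rfl hc
  obtain ⟨χ, hχ⟩ := exists_equiv_of_sq_zero B.mulVecLin (mulVecLin_mulVecLin_eq_zero hB)
    h.symm hc
  let φ := χ.symm.trans ψ
  let P : Matrix.GeneralLinearGroup ι ℂ :=
    ⟨LinearMap.toMatrix' φ.toLinearMap, LinearMap.toMatrix' φ.symm.toLinearMap,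
      by rw [← LinearMap.toMatrix'_comp]; simp, by rw [← LinearMap.toMatrix'_comp]; simp⟩
  have hP : A * (P : Matrix ι ι ℂ) = (P : Matrix ι ι ℂ) * B := by
    apply Matrix.toLin'.injective
    rw [toLin'_mul, toLin'_mul]
    have hP' : Matrix.toLin' (P : Matrix ι ι ℂ) = φ.toLinearMap := toLin'_toMatrix' _
    rw [hP']
    refine LinearMap.ext fun x => ?_
    obtain ⟨⟨x, w, y⟩, rfl⟩ := χ.surjective x
    have h1 := hψ x w y
    have h2 := hχ x w y
    rw [mulVecLin_apply] at h1 h2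
    rw [LinearMap.comp_apply, LinearMap.comp_apply, toLin'_apply, toLin'_apply, h2]
    have hφ : ∀ z, φ.toLinearMap (χ z) = ψ z := fun z =>
      congrArg ψ (χ.symm_apply_apply z)
    rw [hφ, hφ, h1]
  refine ⟨P, ?_⟩
  rw [← hP, Matrix.mul_assoc, ← Units.val_mul, mul_inv_cancel, Units.val_one, Matrix.mul_one]

theorem nilpotentJordanBlock_mul_self {d : ℕ} (hd : d ≤ 2) :
    nilpotentJordanBlock d * nilpotentJordanBlock d = 0 := by
  ext i j
  rw [mul_apply, Matrix.zero_apply]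
  refine Finset.sum_eq_zero fun k _ => ?_
  simp only [nilpotentJordanBlock, of_apply]
  split_ifs <;> simp
  omega

/-- Over `ℂ`, `N` and `N Nᴴ` have equal rank, so a diagonal product reduces the rank to counting
nonzero entries. Only the last row of the block vanishes. -/
theorem nilpotentJordanBlock_mul_conjTranspose (d : ℕ) :
    nilpotentJordanBlock d * (nilpotentJordanBlock d)ᴴ =
      diagonal fun i : Fin d => if (i : ℕ) + 1 < d then 1 else 0 := by
  ext i j
  rw [mul_apply, diagonal_apply]
  simp only [nilpotentJordanBlock, conjTranspose_apply, of_apply, apply_ite star, star_one,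
    star_zero, mul_ite, mul_one, mul_zero]
  by_cases hi : (i : ℕ) + 1 < d
  · rw [Finset.sum_eq_single ⟨(i : ℕ) + 1, hi⟩]
    · simp [hi, Fin.ext_iff, eq_comm]
    · intro k _ hk
      rw [Fin.ne_iff_vne] at hk
      simp only at hk
      split_ifs <;> first | rfl | omega
    · simp
  · rw [Finset.sum_eq_zero]
    · simp [hi]
    · intro k _
      have := k.2
      split_ifs <;> simp
      omega

theorem sum_get_of_coe_eq {a b : ℕ} {l : List ℕ} (hl : (l : Multiset ℕ) = partitionTwoOne a b)
    (f : ℕ → ℕ) : ∑ i : Fin l.length, f (l.get i) = a * f 2 + b * f 1 := by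
  have h1 : ∑ i : Fin l.length, f (l.get i) = (l.map f).sum := by
    rw [← List.sum_ofFn]
    congr 1
    exact (List.ofFn_get (l.map f) ▸ by simp)
  have h2 : (Multiset.map f (l : Multiset ℕ)).sum = a * f 2 + b * f 1 := by
    rw [hl]
    simp [partitionTwoOne]
  rw [h1, ← h2]
  simp

theorem get_of_coe_eq {a b : ℕ} {l : List ℕ} (hl : (l : Multiset ℕ) = partitionTwoOne a b)
    (i : Fin l.length) : l.get i = 1 ∨ l.get i = 2 := by
  have : l.get i ∈ (l : Multiset ℕ) := List.get_mem l i
  rw [hl, partitionTwoOne, Multiset.mem_add] at this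
  exact this.symm.imp Multiset.eq_of_mem_replicate Multiset.eq_of_mem_replicate

theorem blockDiagonal'_jordan_mul_self {a b : ℕ} {l : List ℕ}
    (hl : (l : Multiset ℕ) = partitionTwoOne a b) :
    (blockDiagonal' fun i => nilpotentJordanBlock (l.get i)) *
      (blockDiagonal' fun i => nilpotentJordanBlock (l.get i)) = 0 := by
  rw [← blockDiagonal'_mul]
  have : (fun i => nilpotentJordanBlock (l.get i) * nilpotentJordanBlock (l.get i)) = 0 := by
    funext i
    exact nilpotentJordanBlock_mul_self (by have := get_of_coe_eq hl i; omega)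
  rw [this, blockDiagonal'_zero]

open scoped ComplexOrder in
theorem rank_blockDiagonal'_jordan {a b : ℕ} {l : List ℕ}
    (hl : (l : Multiset ℕ) = partitionTwoOne a b) :
    (blockDiagonal' fun i => nilpotentJordanBlock (l.get i)).rank = a := by
  rw [← rank_self_mul_conjTranspose, blockDiagonal'_conjTranspose, ← blockDiagonal'_mul]
  simp only [nilpotentJordanBlock_mul_conjTranspose]
  rw [blockDiagonal'_diagonal, rank_diagonal, Fintype.card_subtype, Finset.card_filter,
    Fintype.sum_sigma]
  -- A block of size `d` has rank `d - 1`, so only the `a` blocks of size 2 contribute.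
  have h := sum_get_of_coe_eq hl (fun d => d - 1)
  simp only [Nat.add_one_sub_one, mul_one, Nat.sub_self, mul_zero, add_zero] at h
  rw [← h]
  refine Finset.sum_congr rfl fun i _ => ?_
  have key : ∀ d : ℕ, d = 1 ∨ d = 2 →
      ∑ j : Fin d, (if (if (j : ℕ) + 1 < d then (1 : ℂ) else 0) ≠ 0 then 1 else 0) = d - 1 := by
    rintro d (rfl | rfl) <;> simp
  exact key _ (get_of_coe_eq hl i)

theorem hasNilpotentJordanType_partitionTwoOne_iff {ι : Type} [Fintype ι] [DecidableEq ι]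
    {a b : ℕ} (hι : Fintype.card ι = 2 * a + b) (A : Matrix ι ι ℂ) :
    HasNilpotentJordanType A (partitionTwoOne a b) ↔ A * A = 0 ∧ A.rank = a := by
  have hM : ∀ {l : List ℕ} (e : ((i : Fin l.length) × Fin (l.get i)) ≃ ι)
      (_ : (l : Multiset ℕ) = partitionTwoOne a b),
      (reindex e e (blockDiagonal' fun i => nilpotentJordanBlock (l.get i))) *
      (reindex e e (blockDiagonal' fun i => nilpotentJordanBlock (l.get i))) = 0 ∧
      (reindex e e (blockDiagonal' fun i => nilpotentJordanBlock (l.get i))).rank = a := by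
    intro l e hl
    rw [rank_reindex, rank_blockDiagonal'_jordan hl, reindex_apply, submatrix_mul_equiv,
      blockDiagonal'_jordan_mul_self hl]
    exact ⟨rfl, rfl⟩
  constructor
  · rintro ⟨l, hl, e, P, rfl⟩
    obtain ⟨h1, h2⟩ := hM e hl
    set M := reindex e e (blockDiagonal' fun i => nilpotentJordanBlock (l.get i))
    constructor
    · calc _ = (P : Matrix ι ι ℂ) * M * (((P⁻¹ : Matrix.GeneralLinearGroup ι ℂ) : Matrix ι ι ℂ) *
            (P : Matrix ι ι ℂ)) * M *
            ((P⁻¹ : Matrix.GeneralLinearGroup ι ℂ) : Matrix ι ι ℂ) := by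
            simp only [Matrix.mul_assoc]
        _ = (P : Matrix ι ι ℂ) * (M * M) *
            ((P⁻¹ : Matrix.GeneralLinearGroup ι ℂ) : Matrix ι ι ℂ) := by
            rw [← Units.val_mul, inv_mul_cancel, Units.val_one, Matrix.mul_one]
            simp only [Matrix.mul_assoc]
        _ = 0 := by rw [h1, Matrix.mul_zero, Matrix.zero_mul]
    · rw [rank_mul_eq_left_of_isUnit_det _ _ ((isUnit_iff_isUnit_det _).1 (Units.isUnit _)),
        rank_mul_eq_right_of_isUnit_det _ _ ((isUnit_iff_isUnit_det _).1 (Units.isUnit _)), h2]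
  · rintro ⟨h1, h2⟩
    obtain ⟨l, hl⟩ := Quot.exists_rep (partitionTwoOne a b)
    have hl' : (l : Multiset ℕ) = partitionTwoOne a b := hl
    have hc : Fintype.card ((i : Fin l.length) × Fin (l.get i)) = Fintype.card ι := by
      have := sum_get_of_coe_eq hl' id
      simp only [id] at this
      rw [Fintype.card_sigma, hι]
      simp only [Fintype.card_fin]
      rw [this]
      ring
    have e := Fintype.equivOfCardEq hc
    obtain ⟨g1, g2⟩ := hM e hl'
    obtain ⟨P, hP⟩ := exists_conj_of_sq_zero h1 g1 (h2.trans g2.symm)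
    exact ⟨l, hl', e, P, hP⟩

/-! ### Adjoint orbits and rank strata -/

theorem mem_adjointOrbit_self {m : ℕ} (A : SoLie m) : A ∈ adjointOrbit A := by
  rw [mem_adjointOrbit_iff]
  exact ⟨1, by simp⟩

theorem adjointOrbit_symm {m : ℕ} {A B : SoLie m} (h : B ∈ adjointOrbit A) :
    A ∈ adjointOrbit B := by
  rw [mem_adjointOrbit_iff] at h ⊢
  obtain ⟨g, hd, hg, h⟩ := h
  have hu := isUnit_det_of_orthogonal hg
  refine ⟨g⁻¹, ?_, orthogonal_inv hg, ?_⟩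
  · rw [det_nonsing_inv, hd, Ring.inverse_one]
  · calc g⁻¹ * (B : Matrix (Fin m ⊕ Fin m) (Fin m ⊕ Fin m) ℂ)
        = g⁻¹ * (B * g) * g⁻¹ := by
          rw [Matrix.mul_assoc, Matrix.mul_assoc, mul_nonsing_inv _ hu, Matrix.mul_one]
      _ = A * g⁻¹ := by rw [← h, ← Matrix.mul_assoc, nonsing_inv_mul _ hu, Matrix.one_mul]

theorem adjointOrbit_trans {m : ℕ} {A B C : SoLie m} (h : B ∈ adjointOrbit A)
    (h' : C ∈ adjointOrbit B) : C ∈ adjointOrbit A := by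
  rw [mem_adjointOrbit_iff] at *
  obtain ⟨g, hd, hg, h⟩ := h
  obtain ⟨k, kd, hk, h'⟩ := h'
  refine ⟨k * g, by rw [det_mul, hd, kd, mul_one], orthogonal_mul hk hg, ?_⟩
  rw [Matrix.mul_assoc, h, ← Matrix.mul_assoc, h', Matrix.mul_assoc]

theorem adjointOrbit_eq_of_mem {m : ℕ} {A B : SoLie m} (h : B ∈ adjointOrbit A) :
    adjointOrbit B = adjointOrbit A :=
  Set.ext fun _ => ⟨adjointOrbit_trans h, adjointOrbit_trans (adjointOrbit_symm h)⟩

/-- The square-zero elements of rank `r` in `𝔰𝔬_{2m}`. -/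
def sqZeroRank (m r : ℕ) : Set (SoLie m) :=
  {A | (A : Matrix (Fin m ⊕ Fin m) (Fin m ⊕ Fin m) ℂ) *
      (A : Matrix (Fin m ⊕ Fin m) (Fin m ⊕ Fin m) ℂ) = 0 ∧
    (A : Matrix (Fin m ⊕ Fin m) (Fin m ⊕ Fin m) ℂ).rank = r}

/-- Conjugation of an element of `𝔰𝔬_{2m}` by an orthogonal matrix. -/
noncomputable def conjSo {m : ℕ} (g : Matrix (Fin m ⊕ Fin m) (Fin m ⊕ Fin m) ℂ)
    (hg : gᵀ * 𝐉 * g = 𝐉) (A : SoLie m) : SoLie m :=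
  ⟨g * A * g⁻¹, by
    have hu := isUnit_det_of_orthogonal hg
    have hA := (mem_SoLie_iff _).1 A.2
    have h1 : gᵀ * LieAlgebra.Orthogonal.JD (Fin m) ℂ = 𝐉 * g⁻¹ := by
      calc _ = gᵀ * 𝐉 * g * g⁻¹ := by
            rw [Matrix.mul_assoc _ g, mul_nonsing_inv _ hu, Matrix.mul_one]
        _ = _ := by rw [hg]
    have h2 : (g⁻¹)ᵀ * LieAlgebra.Orthogonal.JD (Fin m) ℂ = 𝐉 * g := by
      calc _ = (g⁻¹)ᵀ * 𝐉 * g⁻¹ * g := by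
            rw [Matrix.mul_assoc _ _ g, nonsing_inv_mul _ hu, Matrix.mul_one]
        _ = _ := by rw [orthogonal_inv hg]
    rw [mem_SoLie_iff, transpose_mul, transpose_mul, Matrix.mul_assoc, Matrix.mul_assoc, h1,
      ← Matrix.mul_assoc _ _ g⁻¹, hA, Matrix.neg_mul, Matrix.mul_neg, ← Matrix.mul_assoc,
      ← Matrix.mul_assoc, h2]
    simp only [Matrix.mul_assoc]⟩

theorem conjSo_mul {m : ℕ} (g : Matrix (Fin m ⊕ Fin m) (Fin m ⊕ Fin m) ℂ)
    (hg : gᵀ * 𝐉 * g = 𝐉) (A : SoLie m) :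
    g * A = (conjSo g hg A : Matrix (Fin m ⊕ Fin m) (Fin m ⊕ Fin m) ℂ) * g := by
  change _ = g * _ * g⁻¹ * g
  rw [Matrix.mul_assoc _ g⁻¹, nonsing_inv_mul _ (isUnit_det_of_orthogonal hg), Matrix.mul_one]

theorem mem_sqZeroRank_of_mul_eq {m r : ℕ} {A B : SoLie m}
    {g : Matrix (Fin m ⊕ Fin m) (Fin m ⊕ Fin m) ℂ} (hg : gᵀ * 𝐉 * g = 𝐉)
    (h : g * A = (B : Matrix (Fin m ⊕ Fin m) (Fin m ⊕ Fin m) ℂ) * g) (hA : A ∈ sqZeroRank m r) :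
    B ∈ sqZeroRank m r := by
  have hu := isUnit_det_of_orthogonal hg
  constructor
  · have : (B : Matrix (Fin m ⊕ Fin m) (Fin m ⊕ Fin m) ℂ) * B * g = 0 := by
      rw [Matrix.mul_assoc, ← h, ← Matrix.mul_assoc, ← h, Matrix.mul_assoc, hA.1, Matrix.mul_zero]
    calc (B : Matrix (Fin m ⊕ Fin m) (Fin m ⊕ Fin m) ℂ) * B = B * B * g * g⁻¹ := by
          rw [Matrix.mul_assoc _ g, mul_nonsing_inv _ hu, Matrix.mul_one]
      _ = 0 := by rw [this, Matrix.zero_mul]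
  · rw [← hA.2, ← rank_mul_eq_right_of_isUnit_det g
      (A : Matrix (Fin m ⊕ Fin m) (Fin m ⊕ Fin m) ℂ) hu, h, rank_mul_eq_left_of_isUnit_det g _ hu]

theorem adjointOrbit_subset_sqZeroRank {m r : ℕ} {A : SoLie m} (hA : A ∈ sqZeroRank m r) :
    adjointOrbit A ⊆ sqZeroRank m r := by
  intro B hB
  obtain ⟨g, -, hg, h⟩ := (mem_adjointOrbit_iff _ _).1 hB
  exact mem_sqZeroRank_of_mul_eq hg h hA

theorem exists_orthogonal_of_sqZeroRank {m r : ℕ} {A B : SoLie m} (hA : A ∈ sqZeroRank m r)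
    (hB : B ∈ sqZeroRank m r) : ∃ g : Matrix (Fin m ⊕ Fin m) (Fin m ⊕ Fin m) ℂ,
      gᵀ * 𝐉 * g = 𝐉 ∧ g * A = (B : Matrix (Fin m ⊕ Fin m) (Fin m ⊕ Fin m) ℂ) * g :=
  exists_orthogonal_conj ((mem_SoLie_iff _).1 A.2) ((mem_SoLie_iff _).1 B.2) hA.1 hB.1
    (hA.2.trans hB.2.symm)

theorem adjointOrbit_eq_sqZeroRank {m r : ℕ} (hr : r < m) {A : SoLie m}
    (hA : A ∈ sqZeroRank m r) : adjointOrbit A = sqZeroRank m r := by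
  refine (adjointOrbit_subset_sqZeroRank hA).antisymm fun B hB => ?_
  obtain ⟨g, hg, h⟩ := exists_orthogonal_of_sqZeroRank hA hB
  rw [mem_adjointOrbit_iff]
  rcases det_of_orthogonal hg with hd | hd
  · exact ⟨g, hd, hg, h⟩
  -- A conjugator of determinant `-1` is corrected on the right by a centralising element of
  -- determinant `-1`.
  · obtain ⟨k, hk, kd, hkA⟩ := exists_orthogonal_commute ((mem_SoLie_iff _).1 A.2)
      (hA.2.trans_lt hr)
    refine ⟨g * k, by rw [det_mul, hd, kd]; norm_num, orthogonal_mul hg hk, ?_⟩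
    rw [Matrix.mul_assoc, hkA, ← Matrix.mul_assoc, h, Matrix.mul_assoc]

/-! ### Explicit representatives and the two orbits of rank `m` -/

/-- The skew-symmetric matrix with blocks `[[0, D], [-D, 0]]`, `D` diagonal, padded by zeros and
transported along `e`. -/
def skewBlock {m K r : ℕ} (e : (Fin K ⊕ Fin K) ⊕ Fin r ≃ Fin m) (d : Fin K → ℂ) :
    Matrix (Fin m) (Fin m) ℂ :=
  reindex e e (fromBlocks (fromBlocks 0 (diagonal d) (-diagonal d) 0) 0 0 0)

theorem skewBlock_transpose {m K r : ℕ} (e : (Fin K ⊕ Fin K) ⊕ Fin r ≃ Fin m)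
    (d : Fin K → ℂ) : (skewBlock e d)ᵀ = -skewBlock e d := by
  have h : (fromBlocks (fromBlocks 0 (diagonal d) (-diagonal d) 0) 0 0 0 :
      Matrix ((Fin K ⊕ Fin K) ⊕ Fin r) ((Fin K ⊕ Fin K) ⊕ Fin r) ℂ)ᵀ =
      -fromBlocks (fromBlocks 0 (diagonal d) (-diagonal d) 0) 0 0 0 := by
    rw [fromBlocks_transpose, fromBlocks_transpose, fromBlocks_neg, fromBlocks_neg,
      transpose_neg, diagonal_transpose]
    simp only [transpose_zero, neg_zero, neg_neg]
  rw [skewBlock, transpose_reindex, h]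
  rfl

theorem fromBlocks_diagonal_zero {ι κ : Type} [DecidableEq ι] [DecidableEq κ] (x : ι → ℂ) :
    (fromBlocks (diagonal x) 0 0 0 : Matrix (ι ⊕ κ) (ι ⊕ κ) ℂ) = diagonal (Sum.elim x 0) := by
  have h : (0 : Matrix κ κ ℂ) = diagonal 0 := diagonal_zero'.symm
  rw [h, fromBlocks_diagonal]

theorem skewBlock_mul_conjTranspose {m K r : ℕ} (e : (Fin K ⊕ Fin K) ⊕ Fin r ≃ Fin m)
    (d : Fin K → ℂ) : skewBlock e d * (skewBlock e d)ᴴ =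
      diagonal (Sum.elim (Sum.elim (fun i => d i * star (d i)) fun i => d i * star (d i)) 0 ∘
        e.symm) := by
  rw [skewBlock, conjTranspose_reindex, fromBlocks_conjTranspose, fromBlocks_conjTranspose,
    reindex_apply, reindex_apply, submatrix_mul_equiv, fromBlocks_multiply, fromBlocks_multiply]
  simp only [conjTranspose_zero, Matrix.mul_zero, Matrix.zero_mul, add_zero, zero_add,
    conjTranspose_neg, diagonal_conjTranspose, diagonal_mul_diagonal, Matrix.neg_mul,
    Matrix.mul_neg, neg_neg, neg_zero]
  rw [← submatrix_diagonal_equiv, fromBlocks_diagonal, fromBlocks_diagonal_zero]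
  rfl

/-- The nilpotent element `[[0, S], [0, 0]]` of `𝔰𝔬_{2m}` with `S = skewBlock e d`. -/
def skewBlockSo {m K r : ℕ} (e : (Fin K ⊕ Fin K) ⊕ Fin r ≃ Fin m) (d : Fin K → ℂ) : SoLie m :=
  ⟨fromBlocks 0 (skewBlock e d) 0 0, by
    rw [mem_SoLie_iff, fromBlocks_transpose, skewBlock_transpose]
    simp [LieAlgebra.Orthogonal.JD, fromBlocks_multiply, fromBlocks_neg]⟩

-- `S Sᴴ` is diagonal and carries each `|d i|²` twice, whence the factor 2 in the rank.
open scoped ComplexOrder in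
theorem skewBlockSo_mem {m K r : ℕ} (e : (Fin K ⊕ Fin K) ⊕ Fin r ≃ Fin m) (d : Fin K → ℂ) :
    skewBlockSo e d ∈ sqZeroRank m (2 * (Finset.univ.filter fun i => d i ≠ 0).card) := by
  constructor
  · change fromBlocks 0 _ 0 0 * fromBlocks 0 _ 0 0 = 0
    simp [fromBlocks_multiply]
  · change (fromBlocks 0 (skewBlock e d) 0 0).rank = _
    rw [← rank_self_mul_conjTranspose, fromBlocks_conjTranspose, fromBlocks_multiply]
    simp only [conjTranspose_zero, Matrix.mul_zero, Matrix.zero_mul, add_zero, zero_add,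
      skewBlock_mul_conjTranspose]
    rw [fromBlocks_diagonal_zero, rank_diagonal, Fintype.card_subtype,
      Finset.card_filter, Fintype.sum_sum_type]
    simp only [Sum.elim_inl, Sum.elim_inr, Function.comp_apply]
    have key : ∀ x : (Fin K ⊕ Fin K) ⊕ Fin r → ℂ,
        (∑ a, if x (e.symm a) ≠ 0 then 1 else 0 : ℕ) = ∑ i, if x i ≠ 0 then 1 else 0 :=
      fun x => Equiv.sum_comp e.symm fun i => if x i ≠ 0 then 1 else 0
    have key' := key (Sum.elim (Sum.elim (fun i => d i * star (d i)) fun i => d i * star (d i)) 0)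
    rw [Fintype.sum_sum_type, Fintype.sum_sum_type] at key'
    refine (congrArg₂ (· + ·) (Eq.trans ?_ key') ?_ : _ = _ + 0).trans ?_
    · congr
    · simp
    · rw [Finset.card_filter]
      simp [two_mul]

/-- The elements of `O_{2m}` commuting with `[[0, S], [0, 0]]`, `S` invertible, lie in `SO_{2m}`. -/
theorem det_eq_one_of_commute {m : ℕ} {S : Matrix (Fin m) (Fin m) ℂ} (hS : IsUnit S.det)
    {g : Matrix (Fin m ⊕ Fin m) (Fin m ⊕ Fin m) ℂ} (hg : gᵀ * 𝐉 * g = 𝐉)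
    (h : g * fromBlocks 0 S 0 0 = fromBlocks 0 S 0 0 * g) : g.det = 1 := by
  obtain ⟨a, b, c, d, rfl⟩ : ∃ a b c d, g = fromBlocks a b c d :=
    ⟨_, _, _, _, (fromBlocks_toBlocks g).symm⟩
  -- Commutation gives `c S = 0`. Once `c = 0`, orthogonality gives `aᵀ d = 1`, hence `det g = det a
  -- * det d = 1`.
  have hc : c = 0 := by
    rw [fromBlocks_multiply, fromBlocks_multiply, fromBlocks_inj] at h
    have h1 : c * S = 0 := by simpa using h.2.2.2
    rw [← Matrix.mul_one c, ← mul_nonsing_inv S hS, ← Matrix.mul_assoc, h1, Matrix.zero_mul]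
  subst hc
  rw [LieAlgebra.Orthogonal.JD, fromBlocks_transpose, fromBlocks_multiply, fromBlocks_multiply,
    fromBlocks_inj] at hg
  have h1 : aᵀ * d = 1 := by simpa using hg.2.1
  rw [det_fromBlocks_zero₂₁, ← det_transpose a, ← det_mul, h1, det_one]

/-- The full orthogonal orbit is the whole stratum. The centraliser of `A` lies in `SO`, of index
two in `O`, so the stratum breaks into the orbits of `A` and of its conjugate by any `k` of
determinant `-1`. -/
theorem exists_two_orbits {m : ℕ} (hm : Even m) (hm1 : 1 ≤ m) :
    ∃ A B : SoLie m, A ∈ sqZeroRank m m ∧ B ∈ sqZeroRank m m ∧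
      adjointOrbit A ≠ adjointOrbit B ∧ adjointOrbit A ∪ adjointOrbit B = sqZeroRank m m := by
  obtain ⟨K, hK⟩ := hm
  let e : (Fin K ⊕ Fin K) ⊕ Fin 0 ≃ Fin m :=
    Fintype.equivOfCardEq (by simp; omega)
  let A := skewBlockSo e 1
  have hA : A ∈ sqZeroRank m m := by
    have := skewBlockSo_mem e 1
    simpa [two_mul, ← hK] using this
  have hS : IsUnit (skewBlock e 1).det := by
    have := skewBlock_mul_conjTranspose e 1
    refine isUnit_det_of_right_inverse (B := (skewBlock e 1)ᴴ) ?_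
    rw [this, ← diagonal_one]
    congr 1
    ext i
    rcases h : e.symm i with (j | j) | j
    · simp [h]
    · simp [h]
    · exact j.elim0
  -- Taking the zero matrix here serves only to produce some orthogonal matrix of determinant `-1`.
  obtain ⟨k, hk, kd, -⟩ := exists_orthogonal_commute (m := m) (A := 0) (by simp) (by simp; omega)
  let B := conjSo k hk A
  have hB : B ∈ sqZeroRank m m := mem_sqZeroRank_of_mul_eq hk (conjSo_mul k hk A) hA
  have hku := isUnit_det_of_orthogonal hk
  have hki : (k⁻¹).det = -1 := by
    rw [det_nonsing_inv, kd, Ring.inverse_eq_inv']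
    norm_num
  have hBk : k⁻¹ * (B : Matrix (Fin m ⊕ Fin m) (Fin m ⊕ Fin m) ℂ) = A * k⁻¹ := by
    change k⁻¹ * (k * _ * k⁻¹) = _
    rw [← Matrix.mul_assoc, ← Matrix.mul_assoc, nonsing_inv_mul _ hku, Matrix.one_mul]
  refine ⟨A, B, hA, hB, fun heq => ?_, ?_⟩
  -- A common orbit would make `k⁻¹ * g` centralise `A` with determinant `-1`.
  · have hmem : B ∈ adjointOrbit A := heq ▸ mem_adjointOrbit_self B
    obtain ⟨g, hd, hg, h⟩ := (mem_adjointOrbit_iff _ _).1 hmem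
    have := det_eq_one_of_commute hS (orthogonal_mul (orthogonal_inv hk) hg)
      (by
        change k⁻¹ * g * (A : Matrix (Fin m ⊕ Fin m) (Fin m ⊕ Fin m) ℂ) = A * (k⁻¹ * g)
        rw [Matrix.mul_assoc, h, ← Matrix.mul_assoc, hBk, Matrix.mul_assoc])
    rw [det_mul, hki, hd] at this
    norm_num at this
  · refine (Set.union_subset (adjointOrbit_subset_sqZeroRank hA)
      (adjointOrbit_subset_sqZeroRank hB)).antisymm fun C hC => ?_
    obtain ⟨g, hg, h⟩ := exists_orthogonal_of_sqZeroRank hA hC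
    rw [Set.mem_union, mem_adjointOrbit_iff, mem_adjointOrbit_iff]
    rcases det_of_orthogonal hg with hd | hd
    · exact Or.inl ⟨g, hd, hg, h⟩
    · refine Or.inr ⟨g * k⁻¹, by rw [det_mul, hd, hki]; norm_num,
        orthogonal_mul hg (orthogonal_inv hk), ?_⟩
      rw [Matrix.mul_assoc, hBk, ← Matrix.mul_assoc, h, Matrix.mul_assoc]

/-! ### The variety and Zariski closures -/

/-- The square-zero elements of `𝔰𝔬_{2m}`. -/
def sqZero (m : ℕ) : Set (SoLie m) :=
  {A | (A : Matrix (Fin m ⊕ Fin m) (Fin m ⊕ Fin m) ℂ) *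
      (A : Matrix (Fin m ⊕ Fin m) (Fin m ⊕ Fin m) ℂ) = 0}

theorem exists_mem_sqZeroRank {m : ℕ} {A : SoLie m} (hA : A ∈ sqZero m) :
    ∃ k ≤ m / 2, A ∈ sqZeroRank m (2 * k) := by
  obtain ⟨k, hk⟩ := even_rank_of_skew ((mem_SoLie_iff _).1 A.2) hA
  have := two_mul_rank_le _ hA
  simp at this
  exact ⟨k, by omega, hA, by omega⟩

theorem varietyZ_eq_sqZero {n m : ℕ} (hmn : m ≤ 2 * n + 1) : varietyZ n m = sqZero m := by
  ext A
  refine ⟨fun h => (pow_two _).symm.trans h.1, fun h => ⟨(pow_two _).trans h, ?_⟩⟩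
  obtain ⟨k, hk, -, hr⟩ := exists_mem_sqZeroRank h
  rw [hr]
  omega

/-- Of the `K` diagonal parameters, `k` stay equal to 1 and the others equal `t`, so exactly those
vanish at `t = 0`. -/
theorem exists_degeneration {m k K : ℕ} (hkK : k ≤ K) (hK : 2 * K ≤ m) :
    ∃ N : ℂ → SoLie m, N 0 ∈ sqZeroRank m (2 * k) ∧ (∀ t ≠ 0, N t ∈ sqZeroRank m (2 * K)) ∧
      Continuous fun t => (N t : Matrix (Fin m ⊕ Fin m) (Fin m ⊕ Fin m) ℂ) := by
  let e : (Fin K ⊕ Fin K) ⊕ Fin (m - 2 * K) ≃ Fin m :=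
    Fintype.equivOfCardEq (by simp; omega)
  refine ⟨fun t => skewBlockSo e fun i => if (i : ℕ) < k then 1 else t, ?_, ?_, ?_⟩
  · have := skewBlockSo_mem e fun i => if (i : ℕ) < k then 1 else 0
    have hc : (Finset.univ.filter fun i : Fin K =>
        (if (i : ℕ) < k then (1 : ℂ) else 0) ≠ 0).card = k := by
      simp [Fin.card_filter_val_lt, hkK]
    rwa [hc] at this
  · intro t ht
    have := skewBlockSo_mem e fun i => if (i : ℕ) < k then 1 else t
    have hc : (Finset.univ.filter fun i : Fin K =>
        (if (i : ℕ) < k then (1 : ℂ) else t) ≠ 0).card = K := by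
      rw [Finset.filter_true_of_mem, Finset.card_univ, Fintype.card_fin]
      intro i _
      split_ifs <;> simp [ht]
    rwa [hc] at this
  · have hd : Continuous fun (t : ℂ) (i : Fin K) => if (i : ℕ) < k then (1 : ℂ) else t := by
      refine continuous_pi fun i => ?_
      split_ifs
      · exact continuous_const
      · exact continuous_id
    have hS : Continuous fun t : ℂ => skewBlock e fun i => if (i : ℕ) < k then (1 : ℂ) else t :=
      Continuous.matrix_reindex (Continuous.matrix_fromBlocks
        (Continuous.matrix_fromBlocks continuous_const hd.matrix_diagonal
          hd.matrix_diagonal.neg continuous_const)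
        continuous_const continuous_const continuous_const) e e
    exact Continuous.matrix_fromBlocks continuous_const hS continuous_const continuous_const

theorem sqZeroRank_nonempty {m k : ℕ} (hk : 2 * k ≤ m) : (sqZeroRank m (2 * k)).Nonempty :=
  let ⟨N, hN, _⟩ := exists_degeneration le_rfl hk
  ⟨N 0, hN⟩

theorem zariskiClosure_subset_sqZero {m : ℕ} {S : Set (SoLie m)} (hS : S ⊆ sqZero m) :
    zariskiClosure S ⊆ sqZero m := by
  intro A hA
  change _ * _ = _
  ext i j
  have := hA (∑ k, MvPolynomial.X (i, k) * MvPolynomial.X (k, j)) fun B hB => by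
    have h := congrFun (congrFun (hS hB) i) j
    rw [mul_apply] at h
    simpa using h
  rw [mul_apply]
  simpa using this

theorem zariskiClosure_union {m : ℕ} (S T : Set (SoLie m)) :
    zariskiClosure (S ∪ T) = zariskiClosure S ∪ zariskiClosure T := by
  refine Set.Subset.antisymm (fun A hA => ?_) (Set.union_subset
    (fun A hA p hp => hA p fun B hB => hp B (Or.inl hB))
    (fun A hA p hp => hA p fun B hB => hp B (Or.inr hB)))
  by_contra hcon
  rw [Set.mem_union, not_or] at hcon
  obtain ⟨h1, h2⟩ := hcon
  simp only [zariskiClosure, Set.mem_ofPred_eq, not_forall] at h1 h2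
  obtain ⟨p, hp, hpA⟩ := h1
  obtain ⟨q, hq, hqA⟩ := h2
  have := hA (p * q) fun B hB => by
    rw [map_mul]
    rcases hB with hB | hB
    · rw [hp B hB, zero_mul]
    · rw [hq B hB, mul_zero]
  rw [map_mul] at this
  exact mul_ne_zero hpA hqA this

theorem zariskiClosure_sqZeroRank (m : ℕ) :
    zariskiClosure (sqZeroRank m (2 * (m / 2))) = sqZero m := by
  refine (zariskiClosure_subset_sqZero fun A hA => hA.1).antisymm fun A hA p hp => ?_
  obtain ⟨k, hk, hAk⟩ := exists_mem_sqZeroRank hA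
  obtain ⟨N, h0, ht, hc⟩ := exists_degeneration hk (by omega : 2 * (m / 2) ≤ m)
  obtain ⟨g, hg, h⟩ := exists_orthogonal_of_sqZeroRank h0 hAk
  -- The conjugated curve passes through `A` at `t = 0` and lies in the top stratum elsewhere; a
  -- continuous function vanishing on the dense set `t ≠ 0` vanishes at 0.
  let f : ℂ → ℂ := fun t => MvPolynomial.eval
    (fun ij => (g * N t * g⁻¹ : Matrix (Fin m ⊕ Fin m) (Fin m ⊕ Fin m) ℂ) ij.1 ij.2) p
  have hf : Continuous f := by
    refine (MvPolynomial.continuous_eval p).comp (continuous_pi fun ij => ?_)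
    exact ((continuous_const.matrix_mul hc).matrix_mul continuous_const).matrix_elem _ _
  have hz : ∀ t ∈ ({0}ᶜ : Set ℂ), f t = 0 := fun t h0 =>
    hp (conjSo g hg (N t)) (mem_sqZeroRank_of_mul_eq hg (conjSo_mul g hg _) (ht t h0))
  have hf0 : f 0 = 0 :=
    (isClosed_singleton.preimage hf).closure_subset_iff.2 hz
      ((dense_compl_singleton (0 : ℂ)).closure_eq ▸ Set.mem_univ 0)
  have hA' : (A : Matrix (Fin m ⊕ Fin m) (Fin m ⊕ Fin m) ℂ) = g * N 0 * g⁻¹ := by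
    rw [h, Matrix.mul_assoc, mul_nonsing_inv _ (isUnit_det_of_orthogonal hg), Matrix.mul_one]
  rw [hA']
  exact hf0

/-! ### Orbits by partition and the conclusion -/

theorem hasNilpotentJordanType_iff_mem {m a b : ℕ} (h : a + a + b = m + m) (A : SoLie m) :
    HasNilpotentJordanType (A : Matrix (Fin m ⊕ Fin m) (Fin m ⊕ Fin m) ℂ)
      (partitionTwoOne a b) ↔ A ∈ sqZeroRank m a :=
  hasNilpotentJordanType_partitionTwoOne_iff (by simp; omega) _

theorem nilpotentOrbits_of_lt {m k : ℕ} (hk : 2 * k < m) :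
    nilpotentOrbits m (partitionTwoOne (2 * k) (2 * (m - 2 * k))) = {sqZeroRank m (2 * k)} := by
  ext O
  simp only [nilpotentOrbits, Set.mem_ofPred_eq, Set.mem_singleton_iff,
    hasNilpotentJordanType_iff_mem (by omega : 2 * k + 2 * k + 2 * (m - 2 * k) = m + m)]
  constructor
  · rintro ⟨A, hA, rfl⟩
    exact adjointOrbit_eq_sqZeroRank hk hA
  · rintro rfl
    obtain ⟨A, hA⟩ := sqZeroRank_nonempty hk.le
    exact ⟨A, hA, (adjointOrbit_eq_sqZeroRank hk hA).symm⟩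

theorem nilpotentOrbits_top {m : ℕ} {A B : SoLie m} (hA : A ∈ sqZeroRank m m)
    (hB : B ∈ sqZeroRank m m) (h : adjointOrbit A ∪ adjointOrbit B = sqZeroRank m m) :
    nilpotentOrbits m (partitionTwoOne m 0) = {adjointOrbit A, adjointOrbit B} := by
  ext O
  simp only [nilpotentOrbits, Set.mem_ofPred_eq, Set.mem_insert_iff, Set.mem_singleton_iff,
    hasNilpotentJordanType_iff_mem (by omega : m + m + 0 = m + m)]
  constructor
  · rintro ⟨C, hC, rfl⟩
    rw [← h] at hC
    exact hC.imp adjointOrbit_eq_of_mem adjointOrbit_eq_of_mem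
  · rintro (rfl | rfl)
    · exact ⟨A, hA, rfl⟩
    · exact ⟨B, hB, rfl⟩

theorem sqZero_eq_iUnion {m : ℕ} :
    sqZero m = ⋃ k ∈ Finset.range (m / 2 + 1), sqZeroRank m (2 * k) := by
  ext A
  simp only [Set.mem_iUnion, Finset.mem_range, exists_prop]
  refine ⟨fun h => ?_, fun ⟨k, _, h⟩ => h.1⟩
  obtain ⟨k, hk, h⟩ := exists_mem_sqZeroRank h
  exact ⟨k, by omega, h⟩

theorem mainTheorem6 (n m : ℕ) (hm : 1 ≤ m) (hmn : m ≤ 2 * n + 1) :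
    (Odd m →
      ∃ O : ℕ → Set (SoLie m),
        (∀ k ≤ (m - 1) / 2,
          nilpotentOrbits m (partitionTwoOne (2 * k) (2 * (m - 2 * k))) = {O k}) ∧
        varietyZ n m = (⋃ k ∈ Finset.range ((m - 1) / 2 + 1), O k) ∧
        varietyZ n m = zariskiClosure (O ((m - 1) / 2))) ∧
    (Even m →
      ∃ (O : ℕ → Set (SoLie m)) (OI OII : Set (SoLie m)),
        (∀ k < m / 2,
          nilpotentOrbits m (partitionTwoOne (2 * k) (2 * (m - 2 * k))) = {O k}) ∧
        OI ≠ OII ∧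
        nilpotentOrbits m (partitionTwoOne m 0) = {OI, OII} ∧
        varietyZ n m = (⋃ k ∈ Finset.range (m / 2), O k) ∪ OI ∪ OII ∧
        varietyZ n m = zariskiClosure OI ∪ zariskiClosure OII) := by
  rw [varietyZ_eq_sqZero hmn]
  constructor
  · intro hodd
    have hm2 : (m - 1) / 2 = m / 2 := by
      obtain ⟨k, rfl⟩ := hodd
      omega
    -- For odd `m` no even rank reaches `m`, so every stratum is a single orbit.
    refine ⟨fun k => sqZeroRank m (2 * k), fun k hk => nilpotentOrbits_of_lt (by omega), ?_, ?_⟩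
    · rw [hm2, sqZero_eq_iUnion]
    · rw [hm2]
      exact (zariskiClosure_sqZeroRank m).symm
  · intro heven
    have hm2 : 2 * (m / 2) = m := Nat.two_mul_div_two_of_even heven
    obtain ⟨A, B, hA, hB, hne, hAB⟩ := exists_two_orbits heven hm
    refine ⟨fun k => sqZeroRank m (2 * k), adjointOrbit A, adjointOrbit B,
      fun k hk => nilpotentOrbits_of_lt (by omega), hne, nilpotentOrbits_top hA hB hAB, ?_, ?_⟩
    -- The top index `k = m / 2` is peeled off: its stratum has rank `m` and is the union of the two
    -- orbits.
    · rw [Set.union_assoc, hAB, sqZero_eq_iUnion, Finset.range_add_one,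
        Finset.set_biUnion_insert, hm2, Set.union_comm]
    · rw [← zariskiClosure_union, hAB]
      have := zariskiClosure_sqZeroRank m
      rw [hm2] at this
      exact this.symm
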